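/- Let $K\subset\mathbb R^3$ be an oriented smooth knot, let $n(K)$ be an open tubular neighbourhood of $K$, and let $\pi_K$ be the fundamental group of $\mathbb R^3\setminus n(K)$, based at a point of $\partial n(K)$. Let $m\in\pi_K$ be the meridian (with linking number $1$ with $K$) and $\ell\in\pi_K$ the preferred (Seifert framed) longitude given by loops on $\partial n(K)$ through the base point. A representation $\rho:\pi_K\to\mathrm{GL}(V)$ on a complex vector space is a *KCH representation* if $\rho(m)$ is diagonalizable and has the eigenvalue $1$ with multiplicity $\dim V-1$, i.e. the eigenspace of $1$ has codimension one (no restriction is placed on $\dim V$); it is a *KCH irrep* if moreover it is irreducible. Then $\rho(m)$ has exactly one eigenvalue $\mu_0\neq1$, and an eigenvector for $\mu_0$ is also an eigenvector of $\rho(\ell)$; let $\lambda_0$ be its eigenvalue. Let $U_K\subset(\mathbb C^*)^2$ be the set of all pairs $(\lambda_0,\mu_0)$ obtained from KCH irreps of $\pi_K$. Let $R_0=\mathbb Z[\lambda^{\pm1},\mu^{\pm1}]$. The *cord algebra* of $K$ is the noncommutative unital $R_0$-algebra freely generated by the symbols $[\gamma]$, $\gamma\in\pi_K$, modulo the relations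 $[e]=1-\mu$; $[m\gamma]=[\gamma m]=\mu[\gamma]$ and $[\ell\gamma]=[\gamma\ell]=\lambda[\gamma]$ for all $\gamma\in\pi_K$; and $[\gamma_1\gamma_2]-[\gamma_1m\gamma_2]=[\gamma_1][\gamma_2]$ for all $\gamma_1,\gamma_2\in\pi_K$. An *augmentation* is a unital ring homomorphism $\epsilon$ from the cord algebra to $\mathbb C$. Let $V_K$ be the set of all pairs $(\epsilon(\lambda),\epsilon(\mu))$, for augmentations $\epsilon$ with $\epsilon(\mu)\ne1$. For $X\subset(\mathbb C^*)^2$, a *polynomial of $X$* is a polynomial in $\mathbb Z[\lambda,\mu]$ without repeated factors, not divisible by $\lambda$ or $\mu$, with coprime coefficients, whose zero locus is the maximum dimensional part of the Zariski closure of $X$; it is only considered when this maximum dimensional part is a curve. A *stable $A$-polynomial* $\widetilde A_K(\lambda,\mu)$ is a polynomial of $U_K$; a *2-variable augmentation polynomial* $\mathrm{Aug}_K(\lambda,\mu)$ is $1-\mu$ times a polynomial of $V_K$. Then $U_K=V_K$. If the maximum dimensional part of the Zariski closure of $U_K$ (respectively $V_K$) is a curve, then $\widetilde A_K$ (respectively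 $\mathrm{Aug}_K$) exists. Finally, for every choice of $\widetilde A_K$ and of $\mathrm{Aug}_K$, $$\mathrm{Aug}_K(\lambda,\mu)=\pm(1-\mu)\,\widetilde A_K(\lambda,\mu).$$ -/

import Mathlib

noncomputable section

open scoped ContDiff

namespace KCH

/-! ## Knots, exteriors, meridians and longitudes -/

/-- An oriented smooth knot in `ℝ³`: a smooth immersion of the circle `ℝ / ℤ`, injective on the
circle. -/
structure Knot where
  toFun : ℝ → EuclideanSpace ℝ (Fin 3)
  smooth : ContDiff ℝ ∞ toFun
  periodic : ∀ t, toFun (t + 1) = toFun t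
  injective : ∀ s t, toFun s = toFun t → ∃ n : ℤ, t = s + n
  immersion : ∀ t, deriv toFun t ≠ 0

/-- A parametrized tubular neighbourhood of an oriented knot: an orientation preserving smooth
embedding of `(ℝ / ℤ) × {‖z‖ < 2}` in `ℝ³` with core `K`. The neighbourhood `n(K)` itself is the
image of `(ℝ / ℤ) × {‖z‖ < 1}`. The points of the bounding torus are those with `‖z‖ = 1`. -/
structure Tube (K : Knot) where
  toFun : ℝ × ℂ → EuclideanSpace ℝ (Fin 3)
  smooth : ContDiffOn ℝ ∞ toFun (Set.univ ×ˢ Metric.ball 0 2)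
  core : ∀ t, toFun (t, 0) = K.toFun t
  periodic : ∀ t z, ‖z‖ < 2 → toFun (t + 1, z) = toFun (t, z)
  injective : ∀ s t z w, ‖z‖ < 2 → ‖w‖ < 2 → toFun (s, z) = toFun (t, w) →
    (∃ n : ℤ, t = s + n) ∧ z = w
  /-- The derivative is everywhere invertible and carries the orientation `(∂ₜ, 1, i)` of
  `ℝ × ℂ` to the standard orientation of `ℝ³`. -/
  oriented : ∀ t z, ‖z‖ < 2 → 0 < Matrix.det (Matrix.of
    ![fun i => fderiv ℝ toFun (t, z) (1, 0) i,
      fun i => fderiv ℝ toFun (t, z) (0, 1) i,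
      fun i => fderiv ℝ toFun (t, z) (0, Complex.I) i])

namespace Tube

variable {K : Knot} (T : Tube K)

/-- The knot exterior `ℝ³ ∖ n(K)`. -/
def exterior : Set (EuclideanSpace ℝ (Fin 3)) :=
  {p | ∀ t z, ‖z‖ < 1 → T.toFun (t, z) ≠ p}

theorem mem_exterior (t : ℝ) {z : ℂ} (hz : ‖z‖ = 1) : T.toFun (t, z) ∈ T.exterior := by
  intro s w hw h
  have h2 := (T.injective s t w z (by linarith) (by linarith) h).2
  rw [h2, hz] at hw
  exact lt_irrefl _ hw

/-- The point of the bounding torus with longitudinal coordinate `t` and meridional angle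
`2 π θ`. -/
def torus (q : ℝ × ℝ) : T.exterior :=
  ⟨T.toFun (q.1, Complex.exp ((2 * Real.pi * q.2 : ℝ) * Complex.I)),
    T.mem_exterior _ (Complex.norm_exp_ofReal_mul_I _)⟩

theorem continuous_torus : Continuous T.torus := by
  refine Continuous.subtype_mk ?_ _
  refine T.smooth.continuousOn.comp_continuous (by fun_prop) fun q => ?_
  refine ⟨Set.mem_univ _, ?_⟩
  rw [mem_ball_zero_iff, Complex.norm_exp_ofReal_mul_I]
  norm_num

theorem torus_add_one_left (t θ : ℝ) : T.torus (t + 1, θ) = T.torus (t, θ) := by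
  apply Subtype.ext
  refine T.periodic _ _ ?_
  rw [Complex.norm_exp_ofReal_mul_I]
  norm_num

theorem torus_add_one_right (t θ : ℝ) : T.torus (t, θ + 1) = T.torus (t, θ) := by
  apply Subtype.ext
  have h : Complex.exp ((2 * Real.pi * (θ + 1) : ℝ) * Complex.I)
      = Complex.exp ((2 * Real.pi * θ : ℝ) * Complex.I) := by
    rw [← Complex.exp_periodic ((2 * Real.pi * θ : ℝ) * Complex.I)]
    congr 1
    push_cast
    ring
  change T.toFun (t, _) = T.toFun (t, _)
  rw [h]

/-- The base point, on the bounding torus. -/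
def base : T.exterior := T.torus (0, 0)

/-- The loop `θ ↦ T(0, exp(2πiθ))`, the oriented boundary of a meridian disk. It has linking
number `1` with `K`, as `T` preserves orientation. -/
def meridianLoop : Path T.base T.base where
  toFun s := T.torus (0, s)
  continuous_toFun := T.continuous_torus.comp (by fun_prop)
  source' := rfl
  target' := by
    have h := T.torus_add_one_right 0 0
    rw [zero_add] at h
    exact h

/-- The loop `t ↦ T(t, 1)`, the parallel copy of `K` on the bounding torus. -/
def parallelLoop : Path T.base T.base where
  toFun s := T.torus (s, 0)
  continuous_toFun := T.continuous_torus.comp (by fun_prop)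
  source' := rfl
  target' := by
    have h := T.torus_add_one_left 0 0
    rw [zero_add] at h
    exact h

/-- The knot group `π_K`: the fundamental group of the exterior. Products in Mathlib's
`FundamentalGroup` are in the order of composition of arrows; the opposite group is taken so
that `γ₁ γ₂` runs through `γ₁` first. -/
abbrev Group : Type := (FundamentalGroup T.exterior T.base)ᵐᵒᵖ

/-- The meridian `m`. -/
def m : T.Group :=
  MulOpposite.op (FundamentalGroup.fromPath (Path.Homotopic.Quotient.mk T.meridianLoop))

/-- The class `ℓ` of the parallel copy of `K`. It is the preferred longitude if the framing is
the Seifert framing. -/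
def l : T.Group :=
  MulOpposite.op (FundamentalGroup.fromPath (Path.Homotopic.Quotient.mk T.parallelLoop))

/-- The framing given by the tube is the Seifert framing: `ℓ` vanishes in the first homology of
the exterior, the abelianization of `π_K`. -/
def IsSeifertFramed : Prop := Abelianization.of T.l = 1

end Tube

/-! ## KCH representations -/

/-- `ρ` is a KCH representation with respect to the meridian `m`: `ρ(m)` is diagonalizable and
its eigenspace for the eigenvalue `1` has codimension one (so the multiplicity of `1` is
`dim V - 1`). No restriction is placed on `dim V`. -/
def IsKCHRep {k G V : Type*} [Field k] [Group G] [AddCommGroup V] [Module k V]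
    (m : G) (ρ : Representation k G V) : Prop :=
  (⨆ c : k, Module.End.eigenspace (ρ m) c) = ⊤ ∧
    Module.rank k (V ⧸ Module.End.eigenspace (ρ m) 1) = 1

/-- The set of pairs `(λ₀, μ₀)` for which there is a complex KCH irrep `ρ` and a common
eigenvector `e` of `ρ(m)` and `ρ(ℓ)` with eigenvalue `μ₀ ≠ 1` for `ρ(m)` and `λ₀` for `ρ(ℓ)`.
Coordinate `0` is `λ`, coordinate `1` is `μ`. -/
def eigenvalueSet {G : Type} [Group G] (m l : G) : Set (Fin 2 → ℂ) :=
  {p | ∃ (V : Type) (_ : AddCommGroup V) (_ : Module ℂ V) (ρ : Representation ℂ G V),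
    IsKCHRep m ρ ∧ ρ.IsIrreducible ∧
      ∃ e : V, e ≠ 0 ∧ p 1 ≠ 1 ∧ ρ m e = p 1 • e ∧ ρ l e = p 0 • e}

/-! ## The cord algebra and its augmentations -/

/-- `R₀ = ℤ[λ^{±1}, μ^{±1}]`, the group ring of `ℤ²`. -/
abbrev R₀ : Type := AddMonoidAlgebra ℤ (ℤ × ℤ)

/-- The variable `λ` of `R₀`. -/
def lam : R₀ := AddMonoidAlgebra.single (1, 0) 1

/-- The variable `μ` of `R₀`. -/
def mu : R₀ := AddMonoidAlgebra.single (0, 1) 1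

/-- The defining relations of the cord algebra, in the free noncommutative `R₀`-algebra on the
symbols `[γ]`, `γ ∈ π`, with meridian `m` and longitude `l`. -/
inductive CordRel {G : Type} [Group G] (m l : G) : FreeAlgebra R₀ G → FreeAlgebra R₀ G → Prop
  | unit : CordRel m l (FreeAlgebra.ι R₀ 1) (algebraMap R₀ _ (1 - mu))
  | meridian_left (γ : G) :
      CordRel m l (FreeAlgebra.ι R₀ (m * γ)) (mu • FreeAlgebra.ι R₀ γ)
  | meridian_right (γ : G) :
      CordRel m l (FreeAlgebra.ι R₀ (γ * m)) (mu • FreeAlgebra.ι R₀ γ)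
  | longitude_left (γ : G) :
      CordRel m l (FreeAlgebra.ι R₀ (l * γ)) (lam • FreeAlgebra.ι R₀ γ)
  | longitude_right (γ : G) :
      CordRel m l (FreeAlgebra.ι R₀ (γ * l)) (lam • FreeAlgebra.ι R₀ γ)
  | skein (γ₁ γ₂ : G) :
      CordRel m l (FreeAlgebra.ι R₀ (γ₁ * γ₂) - FreeAlgebra.ι R₀ (γ₁ * m * γ₂))
        (FreeAlgebra.ι R₀ γ₁ * FreeAlgebra.ι R₀ γ₂)

/-- The cord algebra, in terms of the knot group and its peripheral elements. -/
abbrev CordAlgebra {G : Type} [Group G] (m l : G) : Type := RingQuot (CordRel m l)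

/-- The augmentation variety: all pairs `(ε(λ), ε(μ))` with `ε(μ) ≠ 1`, where `ε` is a unital
ring homomorphism from the cord algebra to `ℂ`.
Coordinate `0` is `λ`, coordinate `1` is `μ`. -/
def augmentationVariety {G : Type} [Group G] (m l : G) : Set (Fin 2 → ℂ) :=
  {p | (∃ ε : CordAlgebra m l →+* ℂ,
      ε (algebraMap R₀ _ lam) = p 0 ∧ ε (algebraMap R₀ _ mu) = p 1) ∧ p 1 ≠ 1}

/-! ## The polynomial of a set of points in the plane -/

/-- The dimension of the Zariski closure of `X ⊆ ℂ²`. -/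
def zariskiDim (X : Set (Fin 2 → ℂ)) : WithBot ℕ∞ :=
  ringKrullDim (MvPolynomial (Fin 2) ℂ ⧸ MvPolynomial.vanishingIdeal ℂ X)

/-- The maximum dimensional part of the Zariski closure of `X ⊆ ℂ²`: the union of all irreducible
closed subsets of the closure that have the same dimension as the closure. -/
def maxDimPart (X : Set (Fin 2 → ℂ)) : Set (Fin 2 → ℂ) :=
  {x | ∃ P : Ideal (MvPolynomial (Fin 2) ℂ), P.IsPrime ∧ MvPolynomial.vanishingIdeal ℂ X ≤ P ∧
    ringKrullDim (MvPolynomial (Fin 2) ℂ ⧸ P) = zariskiDim X ∧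
    x ∈ MvPolynomial.zeroLocus ℂ P}

/-- The maximum dimensional part of the Zariski closure of `X` is a curve. -/
def ClosureIsCurve (X : Set (Fin 2 → ℂ)) : Prop := zariskiDim X = 1

/-- `p ∈ ℤ[λ, μ]` is a polynomial of the set `X`: the maximum dimensional part of the closure of
`X` is a curve and is the zero locus of `p`, and `p` has no repeated factors, no factor `λ`
or `μ`, and coprime coefficients. -/
structure IsPolynomialOf (X : Set (Fin 2 → ℂ)) (p : MvPolynomial (Fin 2) ℤ) : Prop where
  curve : ClosureIsCurve X
  zeros : {x : Fin 2 → ℂ | MvPolynomial.aeval x p = 0} = maxDimPart X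
  squarefree : Squarefree p
  not_dvd : ∀ i : Fin 2, ¬ MvPolynomial.X i ∣ p
  coprime : ∀ c : ℤ, (∀ d, c ∣ p.coeff d) → IsUnit c

/-! ## The invariants of a knot with a Seifert framed tube -/

namespace Tube

variable {K : Knot} (T : Tube K)

/-- The set `U_K`. -/
def U : Set (Fin 2 → ℂ) := eigenvalueSet T.m T.l

/-- The set `V_K`. -/
def V : Set (Fin 2 → ℂ) := augmentationVariety T.m T.l

/-- `A` is a stable `A`-polynomial. -/
def IsStableAPolynomial (A : MvPolynomial (Fin 2) ℤ) : Prop := IsPolynomialOf T.U A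

/-- `P` is a 2-variable augmentation polynomial: `1 - μ` times a polynomial of `V_K`. -/
def IsAugmentationPolynomial (P : MvPolynomial (Fin 2) ℤ) : Prop :=
  ∃ q, IsPolynomialOf T.V q ∧ P = (1 - MvPolynomial.X 1) * q

end Tube

end KCH

end

/-!
The equality `U_K = V_K` is a statement about a group with two commuting elements `m`, `ℓ`. In a KCH
representation `ρ(m)` is the identity minus a rank one operator, `ρ(m) v = v - φ(v) e`, where `e` is
the eigenvector for `μ₀ ≠ 1` and `φ(e) = 1 - μ₀`. The matrix coefficient `f(γ) = φ(ρ(γ) e)` then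
satisfies all relations of the cord algebra, where `φ ∘ ρ(ℓ) = λ₀ φ` because `ρ(ℓ)` commutes with
`ρ(m)`. Conversely, let `f(γ)` be the values of an augmentation on the symbols `[γ]`, and let `G` act
by right translation on the span of the translates of `f` in the functions on `G`. The relation
`[γ₁γ₂] - [γ₁mγ₂] = [γ₁][γ₂]` says that `m` acts by `F ↦ F - F(1) f`. A subrepresentation on which
`F ↦ F(1)` vanishes is zero, and any other one contains `f`, so this is an irrep. The elements `m`
and `ℓ` commute because they come from the fundamental group of a torus (`KCH.Tube.commute_m_l`).

Let now `X ⊆ (ℂ^*)²` have a curve as its closure, and let `g` be the greatest common divisor of the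
vanishing ideal of `X`. The codimension one primes of `ℂ[λ, μ]` are principal, so the maximum
dimensional part of the closure is the zero locus of `g` (`KCH.ClosureIsCurve.maxDimPart_eq`). A ring
automorphism of `ℂ` can be composed with augmentations, so `V_K` is stable under `Aut(ℂ)`, and all
conjugates of `g` are proportional to `g`. As the fixed field of `Aut(ℂ)` is `ℚ`
(`Complex.exists_rat_of_forall_ringEquiv`), `g` is proportional to an integer polynomial with coprime
coefficients, whose radical is a polynomial of `X` (`KCH.ClosureIsCurve.exists_isPolynomialOf`).

Two polynomials of the same set have the same zeros. By the Nullstellensatz each divides a power of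
the other over `ℂ`; this descends to `ℤ` as the coefficients are coprime, and as both polynomials are
squarefree they divide each other, so they agree up to sign (`KCH.IsPolynomialOf.eq_or_eq_neg`).
-/

noncomputable section

/-! ### The peripheral subgroup is commutative -/

namespace KCH

/-- The two loops are the images of the two coordinate directions under a map `ℝ² → exterior`, so
their products in either order are images of homotopic paths between opposite corners of the unit
square. -/
theorem Tube.commute_m_l {K : Knot} (T : Tube K) : T.m * T.l = T.l * T.m := by
  let a : Path ((0 : ℝ), (0 : ℝ)) (0, 1) :=
    { toFun := fun s => (0, s), source' := rfl, target' := rfl,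
      continuous_toFun := by fun_prop }
  let a' : Path ((1 : ℝ), (0 : ℝ)) (1, 1) :=
    { toFun := fun s => (1, s), source' := rfl, target' := rfl,
      continuous_toFun := by fun_prop }
  let b : Path ((0 : ℝ), (0 : ℝ)) (1, 0) :=
    { toFun := fun s => (s, 0), source' := rfl, target' := rfl,
      continuous_toFun := by fun_prop }
  let b' : Path ((0 : ℝ), (1 : ℝ)) (1, 1) :=
    { toFun := fun s => (s, 1), source' := rfl, target' := rfl,
      continuous_toFun := by fun_prop }
  have h00 : T.base = T.torus (0, 0) := rfl
  have h11 : T.base = T.torus (1, 1) := by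
    have h1 := T.torus_add_one_left 0 1
    have h2 := T.torus_add_one_right 0 0
    rw [zero_add] at h1 h2
    rw [h1, h2, h00]
  have h := ((SimplyConnectedSpace.paths_homotopic (a.trans b') (b.trans a')).map
    ⟨T.torus, T.continuous_torus⟩)
  have e1 : ((a.trans b').map T.continuous_torus).cast h00 h11
      = T.meridianLoop.trans T.parallelLoop := by
    refine Path.ext (funext fun s => ?_)
    simp only [Path.cast_coe, Path.map_coe, Path.trans_apply, Function.comp]
    split_ifs
    · rfl
    · have h := T.torus_add_one_right (2 * s - 1) 0
      rw [zero_add] at h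
      exact h
  have e2 : ((b.trans a').map T.continuous_torus).cast h00 h11
      = T.parallelLoop.trans T.meridianLoop := by
    refine Path.ext (funext fun s => ?_)
    simp only [Path.cast_coe, Path.map_coe, Path.trans_apply, Function.comp]
    split_ifs
    · rfl
    · have h := T.torus_add_one_left 0 (2 * s - 1)
      rw [zero_add] at h
      exact h
  have h' : (T.meridianLoop.trans T.parallelLoop).Homotopic
      (T.parallelLoop.trans T.meridianLoop) := by
    rw [← e1, ← e2]
    exact h
  exact congrArg MulOpposite.op (Path.Homotopic.Quotient.eq.2 h')

end KCH

/-! ### KCH irreps and augmentations -/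

namespace KCH

section Representations

universe u v

variable {k : Type u} {G : Type*} {V : Type v} [Field k] [Group G] [AddCommGroup V] [Module k V]

/-- In a KCH representation the meridian acts as a rank one perturbation of the identity, in the
direction of its eigenvector `e` with eigenvalue `μ ≠ 1`. -/
theorem IsKCHRep.exists_functional {m : G} {ρ : Representation k G V} (h : IsKCHRep m ρ)
    {e : V} {μ : k} (he : e ≠ 0) (hμ : μ ≠ 1) (hm : ρ m e = μ • e) :
    ∃ φ : V →ₗ[k] k, φ e = 1 - μ ∧ ∀ v, ρ m v = v - φ v • e := by
  set E := Module.End.eigenspace (ρ m) 1 with hE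
  have heE : e ∉ E := by
    rw [hE, Module.End.mem_eigenspace_iff, hm, one_smul]
    intro h1
    have : (μ - 1) • e = 0 := by rw [sub_smul, h1, one_smul, sub_self]
    rcases smul_eq_zero.1 this with h2 | h2
    · exact hμ (sub_eq_zero.1 h2)
    · exact he h2
  have hne : E.mkQ e ≠ 0 := by simpa using heE
  have hfr : Module.finrank k (V ⧸ E) = 1 := by
    rw [Module.finrank, h.2, map_one]
  let b := Module.basisUnique Unit hfr
  let c : V ⧸ E →ₗ[k] k := b.coord ()
  have hb : ∀ x, x = c x • b () := fun x => by
    have := b.sum_repr x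
    rw [Fintype.sum_unique] at this
    exact this.symm
  have hce : c (E.mkQ e) ≠ 0 := fun h0 => hne (by rw [hb (E.mkQ e), h0, zero_smul])
  refine ⟨((1 - μ) * (c (E.mkQ e))⁻¹) • (c ∘ₗ E.mkQ), ?_, fun v => ?_⟩
  · simp only [LinearMap.smul_apply, LinearMap.comp_apply, smul_eq_mul]
    field_simp
  · set a : k := c (E.mkQ v) * (c (E.mkQ e))⁻¹ with ha
    have hw : v - a • e ∈ E := by
      rw [← Submodule.Quotient.mk_eq_zero, ← Submodule.mkQ_apply, hb (E.mkQ _)]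
      simp only [map_sub, map_smul, smul_eq_mul]
      rw [ha, mul_assoc, inv_mul_cancel₀ hce, mul_one, sub_self, zero_smul]
    rw [hE, Module.End.mem_eigenspace_iff, one_smul, map_sub, map_smul, hm] at hw
    have h2 : ρ m v = v - a • e + a • μ • e := by rw [← hw]; abel
    rw [h2]
    have : (((1 - μ) * (c (E.mkQ e))⁻¹) • (c ∘ₗ E.mkQ)) v = a * (1 - μ) := by
      simp only [LinearMap.smul_apply, LinearMap.comp_apply, smul_eq_mul, ha]
      ring
    rw [this]
    module

theorem isKCHRep_of_functional {m : G} {ρ : Representation k G V} {e : V} (φ : V →ₗ[k] k)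
    (he : φ e ≠ 0) (h : ∀ v, ρ m v = v - φ v • e) : IsKCHRep m ρ := by
  have he0 : e ≠ 0 := fun h0 => he (by rw [h0, map_zero])
  have hker : Module.End.eigenspace (ρ m) 1 = LinearMap.ker φ := by
    ext v
    rw [Module.End.mem_eigenspace_iff, h, one_smul, sub_eq_self, LinearMap.mem_ker]
    simp [he0]
  constructor
  · rw [eq_top_iff]
    intro v _
    have hv : v = (v - (φ v / φ e) • e) + (φ v / φ e) • e := by abel
    rw [hv]
    refine Submodule.add_mem _ (Submodule.mem_iSup_of_mem 1 ?_)
      (Submodule.mem_iSup_of_mem (1 - φ e) (Submodule.smul_mem _ _ ?_))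
    · rw [hker, LinearMap.mem_ker, map_sub, map_smul, smul_eq_mul, div_mul_cancel₀ _ he, sub_self]
    · rw [Module.End.mem_eigenspace_iff, h, sub_smul, one_smul]
  · have hsurj : Function.Surjective φ := fun c =>
      ⟨(c / φ e) • e, by rw [map_smul, smul_eq_mul, div_mul_cancel₀ _ he]⟩
    rw [hker]
    apply Cardinal.lift_injective.{u}
    rw [LinearEquiv.lift_rank_eq (φ.quotKerEquivOfSurjective hsurj), Module.rank_self,
      Cardinal.lift_one, Cardinal.lift_one]

end Representations

section Augmentations

variable {G : Type} [Group G] {m l : G}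

/-- The complex numbers `a`, `b` and `f γ` satisfy the relations of the cord algebra, as values of an
augmentation on `λ`, on `μ` and on the symbols `[γ]`. -/
structure IsAugmentationData (m l : G) (a b : ℂ) (f : G → ℂ) : Prop where
  one : f 1 = 1 - b
  meridian_left (γ : G) : f (m * γ) = b * f γ
  meridian_right (γ : G) : f (γ * m) = b * f γ
  longitude_left (γ : G) : f (l * γ) = a * f γ
  longitude_right (γ : G) : f (γ * l) = a * f γ
  skein (γ₁ γ₂ : G) : f (γ₁ * γ₂) - f (γ₁ * m * γ₂) = f γ₁ * f γ₂

theorem isUnit_lam : IsUnit lam :=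
  IsUnit.of_mul_eq_one (AddMonoidAlgebra.single (-1, 0) 1)
    (by
      rw [lam, AddMonoidAlgebra.single_mul_single]
      simp [AddMonoidAlgebra.one_def, Prod.zero_eq_mk])

theorem isUnit_mu : IsUnit mu :=
  IsUnit.of_mul_eq_one (AddMonoidAlgebra.single (0, -1) 1)
    (by
      rw [mu, AddMonoidAlgebra.single_mul_single]
      simp [AddMonoidAlgebra.one_def, Prod.zero_eq_mk])

/-- The ring homomorphism `R₀ → ℂ` with `λ ↦ a` and `μ ↦ b`. -/
def evalR₀ (a b : ℂˣ) : R₀ →+* ℂ :=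
  (AddMonoidAlgebra.lift ℤ ℂ (ℤ × ℤ)
    { toFun := fun n => ((a ^ n.toAdd.1 * b ^ n.toAdd.2 : ℂˣ) : ℂ)
      map_one' := by simp
      map_mul' := fun x y => by
        rw [← Units.val_mul]
        congr 1
        simp only [toAdd_mul, Prod.fst_add, Prod.snd_add, zpow_add]
        exact mul_mul_mul_comm _ _ _ _ }).toRingHom

theorem evalR₀_lam (a b : ℂˣ) : evalR₀ a b lam = a := by
  simp [evalR₀, lam, AddMonoidAlgebra.lift_single]

theorem evalR₀_mu (a b : ℂˣ) : evalR₀ a b mu = b := by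
  simp [evalR₀, mu, AddMonoidAlgebra.lift_single]

theorem mem_augmentationVariety_iff {p : Fin 2 → ℂ} :
    p ∈ augmentationVariety m l ↔
      p 0 ≠ 0 ∧ p 1 ≠ 0 ∧ p 1 ≠ 1 ∧ ∃ f, IsAugmentationData m l (p 0) (p 1) f := by
  constructor
  · rintro ⟨⟨ε, h0, h1⟩, hp⟩
    let ψ : FreeAlgebra R₀ G →+* ℂ := ε.comp (RingQuot.mkRingHom (CordRel m l))
    have hψ : ∀ {x y}, CordRel m l x y → ψ x = ψ y := fun h =>
      congrArg ε (RingQuot.mkRingHom_rel h)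
    have hmk : ∀ r : R₀, ψ (algebraMap R₀ _ r) = ε (algebraMap R₀ _ r) := fun r => by
      rw [← (RingQuot.mkAlgHom R₀ (CordRel m l)).commutes r]
      change ε (RingQuot.mkRingHom (CordRel m l) _) = _
      rw [← RingQuot.mkAlgHom_coe R₀ (CordRel m l)]
      rfl
    have hl : ∀ x, ψ (lam • x) = p 0 * ψ x := fun x => by
      rw [Algebra.smul_def, map_mul, hmk, h0]
    have hm : ∀ x, ψ (mu • x) = p 1 * ψ x := fun x => by
      rw [Algebra.smul_def, map_mul, hmk, h1]
    refine ⟨?_, ?_, hp, fun γ => ψ (FreeAlgebra.ι R₀ γ), ⟨?_, fun γ => ?_, fun γ => ?_,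
      fun γ => ?_, fun γ => ?_, fun γ₁ γ₂ => ?_⟩⟩
    · rw [← h0]
      exact ((isUnit_lam.map (algebraMap R₀ _)).map ε).ne_zero
    · rw [← h1]
      exact ((isUnit_mu.map (algebraMap R₀ _)).map ε).ne_zero
    · rw [hψ CordRel.unit, hmk, map_sub, map_sub, h1, map_one, map_one]
    · rw [hψ (CordRel.meridian_left γ), hm]
    · rw [hψ (CordRel.meridian_right γ), hm]
    · rw [hψ (CordRel.longitude_left γ), hl]
    · rw [hψ (CordRel.longitude_right γ), hl]
    · rw [← map_sub, hψ (CordRel.skein γ₁ γ₂), map_mul]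
  · rintro ⟨h0, h1, hp, f, hf⟩
    refine ⟨?_, hp⟩
    let θ := evalR₀ (Units.mk0 _ h0) (Units.mk0 _ h1)
    have hθl : θ lam = p 0 := evalR₀_lam _ _
    have hθm : θ mu = p 1 := evalR₀_mu _ _
    let _ : Algebra R₀ ℂ := θ.toAlgebra
    have hsm : ∀ (r : R₀) (z : ℂ), r • z = θ r * z := fun r z => Algebra.smul_def r z
    let ε : CordAlgebra m l →ₐ[R₀] ℂ := RingQuot.liftAlgHom R₀
      ⟨FreeAlgebra.lift R₀ f, fun x y h => by
        cases h with
        | unit =>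
          rw [FreeAlgebra.lift_ι_apply, AlgHom.commutes, hf.one]
          change _ = θ _
          rw [map_sub, map_one, hθm]
        | meridian_left γ =>
          rw [map_smul, FreeAlgebra.lift_ι_apply, FreeAlgebra.lift_ι_apply, hsm, hθm,
            hf.meridian_left]
        | meridian_right γ =>
          rw [map_smul, FreeAlgebra.lift_ι_apply, FreeAlgebra.lift_ι_apply, hsm, hθm,
            hf.meridian_right]
        | longitude_left γ =>
          rw [map_smul, FreeAlgebra.lift_ι_apply, FreeAlgebra.lift_ι_apply, hsm, hθl,
            hf.longitude_left]
        | longitude_right γ =>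
          rw [map_smul, FreeAlgebra.lift_ι_apply, FreeAlgebra.lift_ι_apply, hsm, hθl,
            hf.longitude_right]
        | skein γ₁ γ₂ =>
          rw [map_sub, map_mul]
          simp only [FreeAlgebra.lift_ι_apply]
          exact hf.skein γ₁ γ₂⟩
    refine ⟨ε.toRingHom, ?_, ?_⟩
    · exact (ε.commutes lam).trans hθl
    · exact (ε.commutes mu).trans hθm

/-- The matrix coefficient `γ ↦ φ(ρ(γ) e)` of a KCH representation is an augmentation. -/
theorem eigenvalueSet_subset (hml : m * l = l * m) :
    eigenvalueSet m l ⊆ augmentationVariety m l := by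
  rintro p ⟨V, _, _, ρ, hρ, -, e, he, hp, hm, hl⟩
  obtain ⟨φ, hφe, hφ⟩ := hρ.exists_functional he hp hm
  have hinv : ∀ (g : G) (c : ℂ), ρ g e = c • e → c ≠ 0 := by
    rintro g c h rfl
    apply he
    have : ρ g⁻¹ (ρ g e) = e := by
      rw [← Module.End.mul_apply, ← map_mul, inv_mul_cancel, map_one, Module.End.one_apply]
    rw [← this, h, zero_smul, map_zero]
  have hφm : ∀ v, φ (ρ m v) = p 1 * φ v := fun v => by
    rw [hφ, map_sub, map_smul, hφe, smul_eq_mul]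
    ring
  -- As `ρ(l)` commutes with `ρ(m) = 1 - φ(·) e` and scales `e`, it scales `φ` by the same factor.
  have hφl : ∀ v, φ (ρ l v) = p 0 * φ v := fun v => by
    have h1 : ρ m (ρ l v) = ρ l (ρ m v) := by
      rw [← Module.End.mul_apply, ← Module.End.mul_apply, ← map_mul, ← map_mul, hml]
    rw [hφ, hφ, map_sub, map_smul, hl, sub_right_inj, smul_smul] at h1
    rw [smul_left_injective ℂ he h1, mul_comm]
  refine mem_augmentationVariety_iff.2 ⟨hinv l _ hl, hinv m _ hm, hp, fun γ => φ (ρ γ e),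
    ⟨?_, fun γ => ?_, fun γ => ?_, fun γ => ?_, fun γ => ?_, fun γ₁ γ₂ => ?_⟩⟩
  · rw [map_one, Module.End.one_apply, hφe]
  · rw [map_mul, Module.End.mul_apply, hφm]
  · rw [map_mul, Module.End.mul_apply, hm, map_smul, map_smul, smul_eq_mul]
  · rw [map_mul, Module.End.mul_apply, hφl]
  · rw [map_mul, Module.End.mul_apply, hl, map_smul, map_smul, smul_eq_mul]
  · simp only [map_mul, Module.End.mul_apply, hφ, map_sub, map_smul, smul_eq_mul]
    ring

/-- The right regular representation of `G` on all functions `G → ℂ`. -/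
def translation (G : Type) [Group G] : Representation ℂ G (G → ℂ) where
  toFun g := LinearMap.funLeft ℂ ℂ (fun γ => γ * g)
  map_one' := by ext; simp [LinearMap.funLeft]
  map_mul' g h := by ext; simp [LinearMap.funLeft, mul_assoc]

theorem translation_apply (g : G) (F : G → ℂ) (γ : G) : translation G g F γ = F (γ * g) := rfl

/-- The span of the translates of `f`. -/
def translates (f : G → ℂ) : Subrepresentation (translation G) where
  toSubmodule := Submodule.span ℂ (Set.range fun g => translation G g f)
  apply_mem_toSubmodule g v hv := by
    have : Submodule.span ℂ (Set.range fun g => translation G g f) ≤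
        (Submodule.span ℂ (Set.range fun g => translation G g f)).comap (translation G g) := by
      rw [Submodule.span_le]
      rintro _ ⟨h, rfl⟩
      refine Submodule.subset_span ⟨g * h, ?_⟩
      simp only [map_mul]
      rfl
    exact this hv

/-- From an augmentation `f`, the representation on the span of the translates of `f` is a KCH
irrep: `f` is the eigenvector, and evaluation at `1` is the functional. -/
theorem augmentationVariety_subset : augmentationVariety m l ⊆ eigenvalueSet m l := by
  intro p hpV
  obtain ⟨-, -, hp, f, hf⟩ := mem_augmentationVariety_iff.1 hpV
  let W := translates f
  let ρ := W.toRepresentation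
  have hρ : ∀ (g : G) (w : W.toSubmodule) (γ : G), (ρ g w : G → ℂ) γ = (w : G → ℂ) (γ * g) :=
    fun _ _ _ => rfl
  let e : W.toSubmodule := ⟨f, Submodule.subset_span ⟨1, by simp⟩⟩
  let φ : W.toSubmodule →ₗ[ℂ] ℂ := LinearMap.proj (1 : G) ∘ₗ W.toSubmodule.subtype
  have hφ : ∀ w : W.toSubmodule, φ w = (w : G → ℂ) 1 := fun _ => rfl
  have hφe : φ e = 1 - p 1 := hf.one
  have hφe0 : φ e ≠ 0 := by rw [hφe]; exact sub_ne_zero.2 hp.symm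
  have he : e ≠ 0 := fun h0 => hφe0 (by rw [h0, map_zero])
  have hm : ∀ w, ρ m w = w - φ w • e := by
    rintro ⟨w, hw⟩
    apply Subtype.ext
    change translation G m w = w - w 1 • f
    induction hw using Submodule.span_induction with
    | mem x hx =>
      obtain ⟨g, rfl⟩ := hx
      ext γ
      have := hf.skein γ g
      simp only [translation_apply, Pi.sub_apply, Pi.smul_apply, smul_eq_mul, one_mul]
      linear_combination -this
    | zero => simp
    | add x y _ _ hx hy => rw [map_add, hx, hy, Pi.add_apply, add_smul]; abel
    | smul c x _ hx => rw [map_smul, hx, Pi.smul_apply, smul_sub, smul_smul, smul_eq_mul]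
  refine ⟨W.toSubmodule, inferInstance, inferInstance, ρ, isKCHRep_of_functional φ hφe0 hm, ?_,
    e, he, hp, ?_, ?_⟩
  · have : Nontrivial (Subrepresentation ρ) :=
      ⟨⊥, ⊤, fun h => he (by
        have : e ∈ (⊥ : Subrepresentation ρ).toSubmodule := by rw [h]; exact Submodule.mem_top
        exact (Submodule.mem_bot ℂ).1 this)⟩
    refine ⟨fun N => ?_⟩
    by_cases hN : ∀ n ∈ N.toSubmodule, φ n = 0
    · left
      apply Subrepresentation.toSubmodule_injective
      refine (Submodule.eq_bot_iff _).2 fun n hn => ?_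
      ext γ
      have := hN _ (N.apply_mem_toSubmodule γ hn)
      rw [hφ, hρ, one_mul] at this
      exact this
    · right
      push Not at hN
      obtain ⟨n, hn, hn0⟩ := hN
      have heN : e ∈ N.toSubmodule := by
        have h1 : φ n • e ∈ N.toSubmodule := by
          have h2 : φ n • e = n - ρ m n := by rw [hm]; abel
          rw [h2]
          exact Submodule.sub_mem _ hn (N.apply_mem_toSubmodule m hn)
        exact (Submodule.smul_mem_iff _ hn0).1 h1
      apply Subrepresentation.toSubmodule_injective
      refine (Submodule.eq_top_iff').2 fun w => ?_
      have hle : W.toSubmodule ≤ N.toSubmodule.map W.toSubmodule.subtype := by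
        refine Submodule.span_le.2 ?_
        rintro _ ⟨g, rfl⟩
        exact ⟨ρ g e, N.apply_mem_toSubmodule g heN, rfl⟩
      obtain ⟨w', hw', h⟩ := hle w.2
      rwa [← Subtype.ext h]
  · apply Subtype.ext
    ext γ
    exact hf.meridian_right γ
  · apply Subtype.ext
    ext γ
    exact hf.longitude_right γ

theorem eigenvalueSet_eq_augmentationVariety (hml : m * l = l * m) :
    eigenvalueSet m l = augmentationVariety m l :=
  (eigenvalueSet_subset hml).antisymm augmentationVariety_subset

theorem map_mem_augmentationVariety (σ : ℂ →+* ℂ) {p : Fin 2 → ℂ}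
    (hp : p ∈ augmentationVariety m l) : (fun i => σ (p i)) ∈ augmentationVariety m l := by
  obtain ⟨⟨ε, h0, h1⟩, h⟩ := hp
  refine ⟨⟨σ.comp ε, congrArg σ h0, congrArg σ h1⟩, fun hσ => h ?_⟩
  exact σ.injective (hσ.trans (map_one σ).symm)

end Augmentations

end KCH

/-! ### Automorphisms of `ℂ` -/

open Cardinal in
/-- Two embeddings of a countable domain in `ℂ` differ by an automorphism of `ℂ`: over the
domain, both transcendence bases have the cardinality of the continuum. -/
theorem Complex.exists_ringEquiv_comp_eq {R : Type} [CommRing R] [IsDomain R] [Countable R]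
    (i j : R →+* ℂ) (hi : Function.Injective i) (hj : Function.Injective j) :
    ∃ σ : ℂ ≃+* ℂ, ∀ r, σ (i r) = j r := by
  have key : ∀ (K L : Type) [Field K] [Field L] [Algebra R K] [Algebra R L]
      [FaithfulSMul R K] [FaithfulSMul R L] [IsAlgClosed K] [IsAlgClosed L],
      ℵ₀ < #K → #K = #L →
      ∃ σ : K ≃+* L, ∀ r, σ (algebraMap R K r) = algebraMap R L r := by
    intro K L _ _ _ _ _ _ _ _ hK hKL
    obtain ⟨s, hs⟩ := exists_isTranscendenceBasis R K
    obtain ⟨t, ht⟩ := exists_isTranscendenceBasis R L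
    have hR : #R ≤ ℵ₀ := mk_le_aleph0
    have h1 := IsAlgClosed.cardinal_eq_cardinal_transcendence_basis_of_aleph0_lt' _ hs hR hK
    have h2 := IsAlgClosed.cardinal_eq_cardinal_transcendence_basis_of_aleph0_lt' _ ht hR
      (hKL ▸ hK)
    obtain ⟨e⟩ := Cardinal.eq.1 (h1.symm.trans (hKL.trans h2))
    let _ := IsAlgClosed.isAlgClosure_of_transcendence_basis _ hs
    let _ := IsAlgClosed.isAlgClosure_of_transcendence_basis _ ht
    let E : Algebra.adjoin R (Set.range ((↑) : s → K)) ≃ₐ[R]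
        Algebra.adjoin R (Set.range ((↑) : t → L)) :=
      hs.1.aevalEquiv.symm.trans ((MvPolynomial.renameEquiv R e).trans ht.1.aevalEquiv)
    refine ⟨IsAlgClosure.equivOfEquiv K L E.toRingEquiv, fun r => ?_⟩
    rw [IsScalarTower.algebraMap_apply R (Algebra.adjoin R (Set.range ((↑) : s → K))) K,
      IsAlgClosure.equivOfEquiv_algebraMap,
      IsScalarTower.algebraMap_apply R (Algebra.adjoin R (Set.range ((↑) : t → L))) L]
    exact congrArg _ (E.commutes r)
  have h1 : @FaithfulSMul R ℂ i.toAlgebra.toSMul := by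
    let _ := i.toAlgebra
    exact (faithfulSMul_iff_algebraMap_injective R ℂ).2 hi
  have h2 : @FaithfulSMul R ℂ j.toAlgebra.toSMul := by
    let _ := j.toAlgebra
    exact (faithfulSMul_iff_algebraMap_injective R ℂ).2 hj
  exact @key ℂ ℂ _ _ i.toAlgebra j.toAlgebra h1 h2 _ _
    (by rw [Cardinal.mk_complex]; exact Cardinal.aleph0_lt_continuum) rfl

/-- The fixed field of `Aut(ℂ)` is `ℚ`. -/
theorem Complex.exists_rat_of_forall_ringEquiv {z : ℂ} (h : ∀ σ : ℂ ≃+* ℂ, σ z = z) :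
    ∃ q : ℚ, (q : ℂ) = z := by
  have hcount : Countable (Polynomial ℚ) := by
    rw [← Cardinal.mk_le_aleph0_iff]
    exact Polynomial.cardinalMk_le_max.trans (by simp)
  by_cases hz : IsIntegral ℚ z
  · -- Every conjugate `w` of `z` is the image of `z` under some automorphism.
    have hroot : ∀ w, Polynomial.aeval w (minpoly ℚ z) = 0 → w = z := by
      intro w hw
      let F := AdjoinRoot (minpoly ℚ z)
      have : Fact (Irreducible (minpoly ℚ z)) := ⟨minpoly.irreducible hz⟩
      let i : F →ₐ[ℚ] ℂ := AdjoinRoot.liftAlgHom _ (Algebra.ofId ℚ ℂ) z (minpoly.aeval ℚ z)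
      let j : F →ₐ[ℚ] ℂ := AdjoinRoot.liftAlgHom _ (Algebra.ofId ℚ ℂ) w hw
      have : Countable F := (AdjoinRoot.mk_surjective (g := minpoly ℚ z)).countable
      obtain ⟨σ, hσ⟩ := Complex.exists_ringEquiv_comp_eq i.toRingHom j.toRingHom
        i.toRingHom.injective j.toRingHom.injective
      have h1 := hσ (AdjoinRoot.root _)
      have hi : i (AdjoinRoot.root _) = z := AdjoinRoot.liftAlgHom_root ..
      have hj : j (AdjoinRoot.root _) = w := AdjoinRoot.liftAlgHom_root ..
      change σ (i _) = j _ at h1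
      rw [hi, hj, h] at h1
      exact h1.symm
    have hdeg : (minpoly ℚ z).natDegree = 1 := by
      have hsep : (minpoly ℚ z).Separable := (minpoly.irreducible hz).separable
      have hc := Polynomial.card_rootSet_eq_natDegree hsep
        (IsAlgClosed.splits ((minpoly ℚ z).map (algebraMap ℚ ℂ)))
      have hle : Fintype.card ((minpoly ℚ z).rootSet ℂ) ≤ 1 := by
        refine Fintype.card_le_one_iff.2 fun a b => Subtype.ext ?_
        rw [hroot a (Polynomial.aeval_eq_zero_of_mem_rootSet a.2),
          hroot b (Polynomial.aeval_eq_zero_of_mem_rootSet b.2)]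
      have := minpoly.natDegree_pos hz
      omega
    obtain ⟨q, hq⟩ := minpoly.natDegree_eq_one_iff.1 hdeg
    exact ⟨q, by rw [← hq]; simp⟩
  · exfalso
    -- A transcendental `z` has the same minimal relations over `ℚ` as `z + 1`, namely none.
    have ht : Transcendental ℚ z := fun ha => hz ha.isIntegral
    have ht' : Transcendental ℚ (z + 1) := fun ha => hz <| by
      simpa using ha.isIntegral.sub isIntegral_one
    obtain ⟨σ, hσ⟩ := Complex.exists_ringEquiv_comp_eq
      (Polynomial.aeval z : Polynomial ℚ →ₐ[ℚ] ℂ).toRingHom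
      (Polynomial.aeval (z + 1) : Polynomial ℚ →ₐ[ℚ] ℂ).toRingHom
      (transcendental_iff_injective.1 ht) (transcendental_iff_injective.1 ht')
    have h1 := hσ Polynomial.X
    simp [h] at h1

/-! ### Divisibility of polynomials over `ℤ`, `ℚ` and `ℂ` -/

namespace MvPolynomial

variable {σ : Type*}

/-- Divisibility of polynomials does not depend on the field: a linear retraction of the larger
field onto the smaller one turns a quotient over the former into one over the latter. -/
theorem dvd_of_map_dvd_map {K L : Type*} [Field K] [Field L] [Algebra K L]
    {p q : MvPolynomial σ K} (h : map (algebraMap K L) p ∣ map (algebraMap K L) q) : p ∣ q := by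
  obtain ⟨c, hc⟩ := h
  obtain ⟨r, hr⟩ := (Algebra.linearMap K L).exists_leftInverse_of_injective
    (LinearMap.ker_eq_bot.2 (algebraMap K L).injective)
  have hr' : ∀ x : K, r (algebraMap K L x) = x := fun x => LinearMap.congr_fun hr x
  let c' : MvPolynomial σ K := ∑ d ∈ c.support, monomial d (r (c.coeff d))
  have hc' : ∀ d, c'.coeff d = r (c.coeff d) := fun d => by
    classical
    simp only [c', coeff_sum, coeff_monomial, Finset.sum_ite_eq']
    split_ifs with hd
    · rfl
    · rw [notMem_support_iff.1 hd, map_zero]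
  refine ⟨c', ?_⟩
  ext d
  classical
  rw [← hr' (q.coeff d), ← coeff_map, hc, coeff_mul, coeff_mul, map_sum]
  refine Finset.sum_congr rfl fun x _ => ?_
  rw [coeff_map, ← Algebra.smul_def, map_smul, smul_eq_mul, hc']

/-- A polynomial with rational coefficients has an integer multiple with integer coefficients. -/
theorem exists_map_intCast_eq {L : Type*} [Field L] [CharZero L] {s : MvPolynomial σ L}
    (hs : ∀ d, ∃ q : ℚ, (q : L) = s.coeff d) :
    ∃ N : ℤ, N ≠ 0 ∧ ∃ p : MvPolynomial σ ℤ, map (Int.castRingHom L) p = C (N : L) * s := by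
  rw [s.as_sum]
  refine Finset.sum_induction (fun d => monomial d (s.coeff d))
    (fun t => ∃ N : ℤ, N ≠ 0 ∧ ∃ p : MvPolynomial σ ℤ,
      map (Int.castRingHom L) p = C (N : L) * t) ?_ ?_ ?_
  · rintro t₁ t₂ ⟨N₁, h₁, p₁, e₁⟩ ⟨N₂, h₂, p₂, e₂⟩
    refine ⟨N₁ * N₂, mul_ne_zero h₁ h₂, C N₂ * p₁ + C N₁ * p₂, ?_⟩
    rw [map_add, map_mul, map_mul, e₁, e₂, map_C, map_C]
    push_cast
    rw [map_mul]
    simp only [eq_intCast]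
    ring
  · exact ⟨1, one_ne_zero, 0, by simp⟩
  · intro d _
    obtain ⟨q, hq⟩ := hs d
    refine ⟨q.den, by exact_mod_cast q.den_nz, monomial d q.num, ?_⟩
    rw [map_monomial, C_mul_monomial, ← hq]
    congr 1
    have h : (q.den : ℚ) * q = q.num := Rat.den_mul_eq_num q
    have := congrArg (Rat.cast (K := L)) h
    push_cast at this
    simpa using this.symm

/-- The coefficients have no common factor except units. -/
def HasCoprimeCoeffs (p : MvPolynomial σ ℤ) : Prop :=
  ∀ c : ℤ, (∀ d, c ∣ p.coeff d) → IsUnit c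

theorem HasCoprimeCoeffs.of_dvd {p q : MvPolynomial σ ℤ} (hq : q.HasCoprimeCoeffs) (h : p ∣ q) :
    p.HasCoprimeCoeffs := fun c hc =>
  hq c ((C_dvd_iff_dvd_coeff c q).1 (((C_dvd_iff_dvd_coeff c p).2 hc).trans h))

/-- A form of Gauss's lemma. -/
theorem HasCoprimeCoeffs.dvd_of_dvd_C_mul {p q : MvPolynomial σ ℤ} (hp : p.HasCoprimeCoeffs) {N : ℤ}
    (hN : N ≠ 0) (h : p ∣ C N * q) : p ∣ q := by
  induction N using UniqueFactorizationMonoid.induction_on_prime generalizing q with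
  | h₁ => exact absurd rfl hN
  | h₂ u hu => exact (hu.map C).dvd_mul_left.1 h
  | h₃ a b ha hb ih =>
    refine ih ha ?_
    obtain ⟨c, hc⟩ := h
    have hbC : Prime (C b : MvPolynomial σ ℤ) := (prime_C_iff σ).2 hb
    rw [map_mul, mul_assoc] at hc
    rcases hbC.dvd_or_dvd (Dvd.intro _ hc) with h1 | ⟨c', rfl⟩
    · exact absurd (hp b ((C_dvd_iff_dvd_coeff b p).1 h1)) hb.not_isUnit
    · refine ⟨c', mul_left_cancel₀ hbC.ne_zero ?_⟩
      rw [hc]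
      ring

/-- Divisibility over a field of characteristic zero descends to `ℚ` by linear algebra and from there
to `ℤ` by Gauss's lemma. -/
theorem HasCoprimeCoeffs.dvd_of_map_dvd_map {p q : MvPolynomial σ ℤ} (hp : p.HasCoprimeCoeffs)
    {L : Type*} [Field L] [CharZero L]
    (h : map (Int.castRingHom L) p ∣ map (Int.castRingHom L) q) : p ∣ q := by
  have e : Int.castRingHom L = (algebraMap ℚ L).comp (Int.castRingHom ℚ) := RingHom.ext_int _ _
  rw [e, ← map_map, ← map_map] at h
  obtain ⟨c, hc⟩ := MvPolynomial.dvd_of_map_dvd_map h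
  obtain ⟨N, hN, c', hc'⟩ := exists_map_intCast_eq (s := c) fun d => ⟨c.coeff d, Rat.cast_id _⟩
  refine hp.dvd_of_dvd_C_mul hN ⟨c', ?_⟩
  apply map_injective (Int.castRingHom ℚ) Int.cast_injective
  rw [map_mul, map_mul, hc', hc, map_C, eq_intCast]
  ring

theorem exists_eq_C_mul_hasCoprimeCoeffs {p : MvPolynomial σ ℤ} (hp : p ≠ 0) :
    ∃ c : ℤ, c ≠ 0 ∧ ∃ q : MvPolynomial σ ℤ, q.HasCoprimeCoeffs ∧ p = C c * q := by
  set c := p.support.gcd p.coeff with hc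
  have hdvd : ∀ d, c ∣ p.coeff d := fun d => by
    by_cases hd : d ∈ p.support
    · exact Finset.gcd_dvd hd
    · rw [notMem_support_iff.1 hd]; exact dvd_zero _
  obtain ⟨q, hq⟩ := (C_dvd_iff_dvd_coeff c p).2 hdvd
  have hc0 : c ≠ 0 := fun h0 => hp (by rw [hq, h0, map_zero, zero_mul])
  refine ⟨c, hc0, q, fun b hb => ?_, hq⟩
  have h1 : c * b ∣ c * 1 := by
    rw [mul_one]
    nth_rw 2 [hc]
    refine Finset.dvd_gcd fun d _ => ?_
    rw [hq, coeff_C_mul]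
    exact mul_dvd_mul_left c (hb d)
  exact isUnit_of_dvd_one ((mul_dvd_mul_iff_left hc0).1 h1)

theorem aeval_map_intCast {A : Type*} [CommRing A] (x : σ → A) (p : MvPolynomial σ ℤ) :
    aeval x (map (Int.castRingHom A) p) = aeval x p :=
  aeval_map_algebraMap (R := ℤ) A x p

theorem isUnit_int_iff {p : MvPolynomial σ ℤ} : IsUnit p ↔ p = 1 ∨ p = -1 := by
  rw [isUnit_iff_eq_C_of_isReduced]
  constructor
  · rintro ⟨r, hr, rfl⟩
    rcases Int.isUnit_iff.1 hr with rfl | rfl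
    · exact Or.inl (map_one C)
    · exact Or.inr (by rw [map_neg, map_one])
  · rintro (rfl | rfl)
    · exact ⟨1, isUnit_one, (map_one C).symm⟩
    · exact ⟨-1, isUnit_one.neg, by rw [map_neg, map_one]⟩

end MvPolynomial

namespace KCH

open MvPolynomial

/-- By the Nullstellensatz `p` divides a power of `q` over `ℂ`, and hence over `ℤ`. -/
theorem dvd_of_zeros_subset {p q : MvPolynomial (Fin 2) ℤ} (hp : p.HasCoprimeCoeffs)
    (hsq : Squarefree p)
    (h : {x : Fin 2 → ℂ | aeval x p = 0} ⊆ {x : Fin 2 → ℂ | aeval x q = 0}) : p ∣ q := by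
  have hq : map (Int.castRingHom ℂ) q ∈
      (Ideal.span {map (Int.castRingHom ℂ) p}).radical := by
    rw [← vanishingIdeal_zeroLocus_eq_radical (K := ℂ), zeroLocus_span]
    intro x hx
    rw [aeval_map_intCast]
    refine h ?_
    have := hx _ rfl
    rwa [aeval_map_intCast] at this
  obtain ⟨n, hn⟩ := hq
  rw [Ideal.mem_span_singleton, ← map_pow] at hn
  have h1 := hp.dvd_of_map_dvd_map hn
  exact (hsq.dvd_pow_iff_dvd (Nat.succ_ne_zero n)).1 (h1.trans (pow_dvd_pow q n.le_succ))

theorem IsPolynomialOf.eq_or_eq_neg {X : Set (Fin 2 → ℂ)} {p q : MvPolynomial (Fin 2) ℤ}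
    (hp : IsPolynomialOf X p) (hq : IsPolynomialOf X q) : p = q ∨ p = -q := by
  have h : {x : Fin 2 → ℂ | aeval x p = 0} = {x | aeval x q = 0} := hp.zeros.trans hq.zeros.symm
  have h1 := dvd_of_zeros_subset hp.coprime hp.squarefree h.le
  have h2 := dvd_of_zeros_subset hq.coprime hq.squarefree h.ge
  obtain ⟨u, hu⟩ := associated_of_dvd_dvd h2 h1
  rcases isUnit_int_iff.1 u.isUnit with h3 | h3 <;> rw [h3] at hu
  · exact Or.inl (by rw [← hu, mul_one])
  · exact Or.inr (by rw [← hu, mul_neg, mul_one])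

end KCH

/-! ### The curve part of a closed subset of the plane -/

namespace KCH

open MvPolynomial

/-- `g` is a greatest common divisor of the elements of the ideal `I`. It need not lie in `I`. -/
def IsIdealGCD {R : Type*} [CommRing R] (I : Ideal R) (g : R) : Prop :=
  ∀ d, d ∣ g ↔ ∀ f ∈ I, d ∣ f

theorem exists_isIdealGCD {R : Type*} [CommRing R] [IsDomain R] [UniqueFactorizationMonoid R]
    [IsNoetherianRing R] (I : Ideal R) : ∃ g, IsIdealGCD I g := by
  obtain ⟨S, rfl⟩ := IsNoetherian.noetherian I
  classical
  let _ : NormalizationMonoid R :=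
    UniqueFactorizationMonoid.strongNormalizationMonoid.toNormalizationMonoid
  let _ : NormalizedGCDMonoid R := UniqueFactorizationMonoid.toNormalizedGCDMonoid R
  refine ⟨S.gcd id, fun d => ?_⟩
  rw [Finset.dvd_gcd_iff]
  have h1 : (∀ b ∈ S, d ∣ id b) ↔ Ideal.span (S : Set R) ≤ Ideal.span {d} := by
    rw [Ideal.span_le]
    exact forall₂_congr fun b _ => Ideal.mem_span_singleton.symm
  rw [h1]
  exact forall₂_congr fun b _ => Ideal.mem_span_singleton

theorem IsIdealGCD.ne_zero {R : Type*} [CommRing R] {I : Ideal R}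
    {g : R} (hg : IsIdealGCD I g)
    (hI : I ≠ ⊥) : g ≠ 0 := by
  rintro rfl
  exact hI ((Submodule.eq_bot_iff I).2 fun f hf => zero_dvd_iff.1 ((hg 0).1 dvd_rfl f hf))

theorem ringKrullDim_plane : ringKrullDim (MvPolynomial (Fin 2) ℂ) = 2 := by
  rw [ringKrullDim_of_isNoetherianRing, ringKrullDim_eq_zero_of_field, zero_add,
    Nat.card_fin]
  rfl

theorem ringKrullDim_quotient_span_le_one {f : MvPolynomial (Fin 2) ℂ} (hf : f ≠ 0) :
    ringKrullDim (MvPolynomial (Fin 2) ℂ ⧸ Ideal.span {f}) ≤ 1 := by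
  have h := ringKrullDim_quotient_succ_le_of_nonZeroDivisor (mem_nonZeroDivisors_of_ne_zero hf)
  rw [ringKrullDim_plane] at h
  refine ENat.WithBot.add_le_add_one_right_iff.1 (h.trans_eq ?_)
  norm_num

theorem ringKrullDim_quotient_succ_le_of_lt {R : Type*} [CommRing R] {P Q : Ideal R} [Q.IsPrime]
    (h : Q < P) : ringKrullDim (R ⧸ P) + 1 ≤ ringKrullDim (R ⧸ Q) := by
  obtain ⟨hle, g, hgP, hg⟩ := SetLike.lt_iff_le_and_exists.1 h
  have hg0 : Ideal.Quotient.mk Q g ≠ 0 := fun h0 => hg (Ideal.Quotient.eq_zero_iff_mem.1 h0)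
  let π : (R ⧸ Q) ⧸ Ideal.span {Ideal.Quotient.mk Q g} →+* R ⧸ P :=
    Ideal.Quotient.lift _ (Ideal.Quotient.factor hle) fun a ha => by
      obtain ⟨b, rfl⟩ := Ideal.mem_span_singleton.1 ha
      rw [map_mul, Ideal.Quotient.factor_mk, Ideal.Quotient.eq_zero_iff_mem.2 hgP, zero_mul]
  have h1 := ringKrullDim_le_of_surjective π
    (Ideal.Quotient.lift_surjective_of_surjective _ _ (Ideal.Quotient.factor_surjective _))
  have h2 := ringKrullDim_quotient_succ_le_of_nonZeroDivisor (mem_nonZeroDivisors_of_ne_zero hg0)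
  exact le_trans (by gcongr) h2

/-- A prime ideal of codimension one in `ℂ[λ, μ]` is principal. -/
theorem exists_prime_eq_span {P : Ideal (MvPolynomial (Fin 2) ℂ)} [P.IsPrime]
    (hdim : ringKrullDim (MvPolynomial (Fin 2) ℂ ⧸ P) = 1) :
    ∃ f, Prime f ∧ P = Ideal.span {f} := by
  have hP : P ≠ ⊥ := by
    rintro rfl
    rw [ringKrullDim_eq_of_ringEquiv (RingEquiv.quotientBot _), ringKrullDim_plane] at hdim
    exact absurd hdim (by decide)
  obtain ⟨f, hfP, hf⟩ := Ideal.IsPrime.exists_mem_prime_of_ne_bot inferInstance hP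
  refine ⟨f, hf, ?_⟩
  have hle : Ideal.span {f} ≤ P := (Ideal.span_singleton_le_iff_mem P).2 hfP
  have : (Ideal.span {f}).IsPrime := (Ideal.span_singleton_prime hf.ne_zero).2 hf
  -- Otherwise `0 < (f) < P` would make the dimension drop twice.
  by_contra hne
  have h1 := ringKrullDim_quotient_succ_le_of_lt (lt_of_le_of_ne hle (Ne.symm hne))
  have h2 := h1.trans (ringKrullDim_quotient_span_le_one hf.ne_zero)
  rw [hdim] at h2
  exact absurd h2 (by decide)

/-- A plane curve is not a point. -/
theorem not_isMaximal_span_singleton {f : MvPolynomial (Fin 2) ℂ} :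
    ¬ (Ideal.span {f}).IsMaximal := by
  intro h
  obtain ⟨a, ha⟩ := isMaximal_iff_eq_vanishingIdeal_singleton.1 h
  have hdvd : ∀ i, f ∣ X i - C (a i) := fun i => by
    rw [← Ideal.mem_span_singleton, ha, mem_vanishingIdeal_singleton_iff]
    simp
  have hne : ∀ i, (X i - C (a i) : MvPolynomial (Fin 2) ℂ) ≠ 0 := fun i h0 => by
    have := congrArg (aeval fun _ => a i + 1) h0
    simp at this
  have hdeg : ∀ i j, i ≠ j → degreeOf j f = 0 := fun i j hij => by
    obtain ⟨c, hc⟩ := hdvd i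
    have hf0 : f ≠ 0 := fun h0 => hne i (by rw [hc, h0, zero_mul])
    have hc0 : c ≠ 0 := fun h0 => hne i (by rw [hc, h0, mul_zero])
    have h1 : degreeOf j (X i - C (a i) : MvPolynomial (Fin 2) ℂ) ≤ 0 := by
      refine (degreeOf_sub_le j _ _).trans ?_
      rw [degreeOf_C, degreeOf_X_of_ne hij.symm]
      rfl
    rw [hc, degreeOf_mul_eq hf0 hc0] at h1
    omega
  have hd : f.totalDegree = 0 := by
    rw [totalDegree_eq_zero_iff]
    intro d hd j
    exact Nat.le_zero.1 ((monomial_le_degreeOf j hd).trans_eq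
      (hdeg (j + 1) j (by fin_cases j <;> decide)))
  rw [totalDegree_eq_zero_iff_eq_C] at hd
  have hf0 : f ≠ 0 := fun h0 => by
    obtain ⟨c, hc⟩ := hdvd 0
    exact hne 0 (by rw [hc, h0, zero_mul])
  have hu : IsUnit f := by
    rw [hd]
    refine (IsUnit.mk0 _ fun h0 => hf0 ?_).map C
    rw [hd, h0, map_zero]
  exact h.ne_top (Ideal.span_singleton_eq_top.2 hu)

theorem one_le_ringKrullDim_quotient_span {f : MvPolynomial (Fin 2) ℂ} (hf : Prime f) :
    1 ≤ ringKrullDim (MvPolynomial (Fin 2) ℂ ⧸ Ideal.span {f}) := by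
  have : (Ideal.span {f}).IsPrime := (Ideal.span_singleton_prime hf.ne_zero).2 hf
  by_contra! hlt
  have hle : ringKrullDim (MvPolynomial (Fin 2) ℂ ⧸ Ideal.span {f}) ≤ 0 :=
    ENat.WithBot.lt_add_one_iff.1 (by simpa using hlt)
  have : Ring.KrullDimLE 0 (MvPolynomial (Fin 2) ℂ ⧸ Ideal.span {f}) :=
    (Ring.krullDimLE_iff).2 (by exact_mod_cast hle)
  exact not_isMaximal_span_singleton
    (Ideal.Quotient.maximal_of_isField (Ideal.span {f}) Ring.KrullDimLE.isField_of_isDomain)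

theorem exists_prime_dvd_of_aeval_eq_zero {g : MvPolynomial (Fin 2) ℂ} (hg : g ≠ 0)
    {x : Fin 2 → ℂ} (hx : aeval x g = 0) : ∃ f, Prime f ∧ f ∣ g ∧ aeval x f = 0 := by
  obtain ⟨s, hs, u, hu⟩ := UniqueFactorizationMonoid.exists_prime_factors g hg
  have h1 : aeval x s.prod = 0 := by
    rw [← hu, map_mul] at hx
    exact (mul_eq_zero.1 hx).resolve_right (u.isUnit.map (aeval x)).ne_zero
  rw [map_multiset_prod, Multiset.prod_eq_zero_iff, Multiset.mem_map] at h1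
  obtain ⟨f, hf, h0⟩ := h1
  exact ⟨f, hs f hf, (Multiset.dvd_prod hf).trans ⟨u, hu.symm⟩, h0⟩

theorem ClosureIsCurve.vanishingIdeal_ne_bot {X : Set (Fin 2 → ℂ)} (hX : ClosureIsCurve X) :
    vanishingIdeal ℂ X ≠ ⊥ := by
  intro h
  rw [ClosureIsCurve, zariskiDim, h, ringKrullDim_eq_of_ringEquiv (RingEquiv.quotientBot _),
    ringKrullDim_plane] at hX
  exact absurd hX (by decide)

/-- If the closure of `X` is a curve, its maximum dimensional part is the zero locus of the
greatest common divisor of the vanishing ideal: its components are the zero loci of the prime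
factors of the latter. -/
theorem ClosureIsCurve.maxDimPart_eq {X : Set (Fin 2 → ℂ)} (hX : ClosureIsCurve X)
    {g : MvPolynomial (Fin 2) ℂ} (hg : IsIdealGCD (vanishingIdeal ℂ X) g) :
    maxDimPart X = {x | aeval x g = 0} := by
  ext x
  constructor
  · rintro ⟨P, hP, hXP, hdim, hx⟩
    obtain ⟨f, -, rfl⟩ := exists_prime_eq_span (hdim.trans hX)
    have hfg : f ∣ g := (hg f).2 fun p hp => Ideal.mem_span_singleton.1 (hXP hp)
    exact hx g (Ideal.mem_span_singleton.2 hfg)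
  · intro hx
    have hg0 := hg.ne_zero hX.vanishingIdeal_ne_bot
    obtain ⟨f, hf, hfg, hfx⟩ := exists_prime_dvd_of_aeval_eq_zero hg0 hx
    refine ⟨Ideal.span {f}, (Ideal.span_singleton_prime hf.ne_zero).2 hf,
      fun p hp => Ideal.mem_span_singleton.2 ((hg f).1 hfg p hp), ?_, ?_⟩
    · exact (le_antisymm (ringKrullDim_quotient_span_le_one hf.ne_zero)
        (one_le_ringKrullDim_quotient_span hf)).trans (Eq.symm hX)
    · rw [zeroLocus_span]
      rintro p rfl
      exact hfx

/-- If no point of `X` has a vanishing coordinate, no variable divides the vanishing ideal: it is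
stable under division by variables, so this would go on indefinitely. -/
theorem IsIdealGCD.not_X_dvd {X : Set (Fin 2 → ℂ)} (hX0 : ∀ x ∈ X, ∀ i, x i ≠ 0)
    (hI : vanishingIdeal ℂ X ≠ ⊥) {g : MvPolynomial (Fin 2) ℂ}
    (hg : IsIdealGCD (vanishingIdeal ℂ X) g) (i : Fin 2) : ¬ MvPolynomial.X i ∣ g := by
  intro hi
  have key : ∀ n : ℕ, ∀ f ∈ vanishingIdeal ℂ X, f.totalDegree = n → f = 0 := by
    intro n
    induction n using Nat.strong_induction_on with
    | _ n ih =>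
      intro f hf hn
      obtain ⟨c, rfl⟩ := (hg _).1 hi f hf
      by_contra h0
      have hc0 : c ≠ 0 := fun h => h0 (by rw [h, mul_zero])
      have hc : c ∈ vanishingIdeal ℂ X := fun x hx => by
        have := hf x hx
        rw [map_mul, aeval_X] at this
        exact (mul_eq_zero.1 this).resolve_left (hX0 x hx i)
      rw [totalDegree_mul_of_isDomain (X_ne_zero i) hc0, totalDegree_X] at hn
      exact hc0 (ih _ (by omega) c hc rfl)
  exact hI ((Submodule.eq_bot_iff _).2 fun f hf => key _ f hf rfl)

/-! ### Descent of the equation of a curve to `ℤ` -/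

/-- The vanishing ideal of an `Aut(ℂ)`-stable set is `Aut(ℂ)`-stable. -/
theorem map_mem_vanishingIdeal {X : Set (Fin 2 → ℂ)}
    (hX : ∀ σ : ℂ ≃+* ℂ, ∀ x ∈ X, (fun i => σ (x i)) ∈ X) (σ : ℂ ≃+* ℂ)
    {f : MvPolynomial (Fin 2) ℂ} (hf : f ∈ vanishingIdeal ℂ X) :
    map (σ : ℂ →+* ℂ) f ∈ vanishingIdeal ℂ X := by
  intro x hx
  have h1 := hf _ (hX σ.symm x hx)
  have h2 : aeval x (map (σ : ℂ →+* ℂ) f) = σ (aeval (fun i => σ.symm (x i)) f) := by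
    have h3 := map_aeval (fun i => σ.symm (x i)) (σ : ℂ →+* ℂ) f
    simp only [RingEquiv.coe_toRingHom, RingEquiv.apply_symm_apply] at h3
    rw [h3, aeval_eq_eval₂Hom, coe_eval₂Hom, eval₂_map]
    rfl
  rw [h2, h1, map_zero]

theorem IsIdealGCD.associated_map {X : Set (Fin 2 → ℂ)}
    (hX : ∀ σ : ℂ ≃+* ℂ, ∀ x ∈ X, (fun i => σ (x i)) ∈ X) {g : MvPolynomial (Fin 2) ℂ}
    (hg : IsIdealGCD (vanishingIdeal ℂ X) g) (σ : ℂ ≃+* ℂ) :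
    Associated (map (σ : ℂ →+* ℂ) g) g := by
  have hinv : ∀ (τ : ℂ ≃+* ℂ) (f : MvPolynomial (Fin 2) ℂ),
      map (τ : ℂ →+* ℂ) (map (τ.symm : ℂ →+* ℂ) f) = f := fun τ f => by
    rw [map_map, RingEquiv.comp_symm, map_id]
  have key : ∀ τ : ℂ ≃+* ℂ, map (τ : ℂ →+* ℂ) g ∣ g := fun τ => by
    refine (hg _).2 fun f hf => ?_
    rw [← hinv τ f]
    exact map_dvd (map (τ : ℂ →+* ℂ)) ((hg g).1 dvd_rfl _ (map_mem_vanishingIdeal hX τ.symm hf))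
  refine associated_of_dvd_dvd (key σ) ?_
  have := map_dvd (map (σ : ℂ →+* ℂ)) (key σ.symm)
  rwa [hinv] at this

/-- A polynomial whose conjugates are all proportional to it is proportional to one with coprime
integer coefficients. -/
theorem exists_associated_map_intCast {g : MvPolynomial (Fin 2) ℂ} (hg : g ≠ 0)
    (h : ∀ σ : ℂ ≃+* ℂ, Associated (map (σ : ℂ →+* ℂ) g) g) :
    ∃ p : MvPolynomial (Fin 2) ℤ, p ≠ 0 ∧ p.HasCoprimeCoeffs ∧
      Associated (map (Int.castRingHom ℂ) p) g := by
  obtain ⟨d₀, hd₀⟩ := ne_zero_iff.1 hg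
  -- Once one coefficient is `1`, all coefficients are fixed by `Aut(ℂ)`.
  have hfix : ∀ (σ : ℂ ≃+* ℂ) d, σ ((g.coeff d₀)⁻¹ * g.coeff d) = (g.coeff d₀)⁻¹ * g.coeff d := by
    intro σ d
    obtain ⟨u, hu⟩ := (h σ).symm
    obtain ⟨c, -, hc⟩ := isUnit_iff_eq_C_of_isReduced.1 u.isUnit
    have hσ : ∀ e, σ (g.coeff e) = g.coeff e * c := fun e => by
      have := congrArg (coeff e) hu
      rw [hc, mul_comm, coeff_C_mul, coeff_map, mul_comm] at this
      exact this.symm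
    have hc0 : c ≠ 0 := fun h0 => by
      have := hσ d₀
      rw [h0, mul_zero, map_eq_zero_iff σ σ.injective] at this
      exact hd₀ this
    rw [map_mul, map_inv₀, hσ, hσ]
    field_simp
  obtain ⟨N, hN, p₀, hp₀⟩ := exists_map_intCast_eq (s := C (g.coeff d₀)⁻¹ * g) fun d => by
    rw [coeff_C_mul]
    exact Complex.exists_rat_of_forall_ringEquiv fun σ => hfix σ d
  have hunit : ∀ c : ℂ, c ≠ 0 → IsUnit (C c : MvPolynomial (Fin 2) ℂ) := fun c hc =>
    (IsUnit.mk0 c hc).map C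
  have hNC : (N : ℂ) ≠ 0 := Int.cast_ne_zero.2 hN
  have hassoc : Associated (map (Int.castRingHom ℂ) p₀) g := by
    rw [hp₀]
    exact (associated_unit_mul_left _ _ (hunit _ hNC)).trans
      (associated_unit_mul_left _ _ (hunit _ (inv_ne_zero hd₀)))
  have hp₀0 : p₀ ≠ 0 := by
    rintro rfl
    rw [map_zero] at hassoc
    exact hg (hassoc.eq_zero_iff.1 rfl)
  obtain ⟨c, hc, p, hp, rfl⟩ := exists_eq_C_mul_hasCoprimeCoeffs hp₀0
  refine ⟨p, right_ne_zero_of_mul hp₀0, hp, Associated.trans (Associated.symm ?_) hassoc⟩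
  rw [map_mul, map_C]
  exact associated_unit_mul_left _ _ (hunit _ (by simpa using hc))

theorem exists_squarefree_dvd_dvd_pow {R : Type*} [CommRing R] [IsDomain R]
    [UniqueFactorizationMonoid R] {a : R} (ha : a ≠ 0) :
    ∃ r, Squarefree r ∧ r ∣ a ∧ ∃ n, a ∣ r ^ n := by
  let _ : NormalizationMonoid R :=
    UniqueFactorizationMonoid.strongNormalizationMonoid.toNormalizationMonoid
  exact ⟨UniqueFactorizationMonoid.radical a, UniqueFactorizationMonoid.squarefree_radical,
    UniqueFactorizationMonoid.radical_dvd_self,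
    UniqueFactorizationMonoid.exists_dvd_radical_self_pow ha⟩

/-- An `Aut(ℂ)`-stable subset of `(ℂ^*)²` whose closure is a curve has a polynomial. -/
theorem ClosureIsCurve.exists_isPolynomialOf {X : Set (Fin 2 → ℂ)} (hX : ClosureIsCurve X)
    (hX0 : ∀ x ∈ X, ∀ i, x i ≠ 0)
    (hσ : ∀ σ : ℂ ≃+* ℂ, ∀ x ∈ X, (fun i => σ (x i)) ∈ X) :
    ∃ p, IsPolynomialOf X p := by
  obtain ⟨g, hg⟩ := exists_isIdealGCD (vanishingIdeal ℂ X)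
  have hI := hX.vanishingIdeal_ne_bot
  obtain ⟨p, hp0, hp, hpg⟩ := exists_associated_map_intCast (hg.ne_zero hI) (hg.associated_map hσ)
  obtain ⟨r, hr, hrp, n, hpr⟩ := exists_squarefree_dvd_dvd_pow hp0
  refine ⟨r, hX, ?_, hr, fun i hi => ?_, hp.of_dvd hrp⟩
  · rw [hX.maxDimPart_eq hg]
    ext x
    change aeval x r = 0 ↔ aeval x g = 0
    have hiff : aeval x p = 0 ↔ aeval x g = 0 := by
      rw [← aeval_map_intCast]
      exact (hpg.map (aeval x)).eq_zero_iff
    rw [← hiff]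
    constructor
    · intro h
      exact zero_dvd_iff.1 (h ▸ map_dvd (aeval x) hrp)
    · intro h
      have := map_dvd (aeval x) hpr
      rw [h, map_pow] at this
      exact eq_zero_of_pow_eq_zero (zero_dvd_iff.1 this)
  · refine hg.not_X_dvd hX0 hI i ?_
    have := map_dvd (map (Int.castRingHom ℂ)) (hi.trans hrp)
    rw [map_X] at this
    exact this.trans hpg.dvd

theorem exists_isPolynomialOf_augmentationVariety {G : Type} [Group G] {m l : G}
    (h : ClosureIsCurve (augmentationVariety m l)) :
    ∃ p, IsPolynomialOf (augmentationVariety m l) p := by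
  refine h.exists_isPolynomialOf (fun x hx i => ?_)
    fun σ x hx => map_mem_augmentationVariety (σ : ℂ →+* ℂ) hx
  obtain ⟨h0, h1, -⟩ := mem_augmentationVariety_iff.1 hx
  fin_cases i
  · exact h0
  · exact h1

end KCH

end

theorem mainTheorem3 (K : KCH.Knot) (T : KCH.Tube K) (hT : T.IsSeifertFramed) :
    T.U = T.V ∧
    (KCH.ClosureIsCurve T.U → ∃ A, T.IsStableAPolynomial A) ∧
    (KCH.ClosureIsCurve T.V → ∃ P, T.IsAugmentationPolynomial P) ∧
    ∀ A P : MvPolynomial (Fin 2) ℤ,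
      T.IsStableAPolynomial A → T.IsAugmentationPolynomial P →
        P = (1 - MvPolynomial.X 1) * A ∨ P = -((1 - MvPolynomial.X 1) * A) := by
  have hUV : T.U = T.V := KCH.eigenvalueSet_eq_augmentationVariety T.commute_m_l
  refine ⟨hUV, fun h => ?_, fun h => ?_, ?_⟩
  · unfold KCH.Tube.IsStableAPolynomial
    rw [hUV] at h ⊢
    exact KCH.exists_isPolynomialOf_augmentationVariety h
  · obtain ⟨q, hq⟩ := KCH.exists_isPolynomialOf_augmentationVariety h
    exact ⟨_, q, hq, rfl⟩
  · rintro A P hA ⟨q, hq, rfl⟩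
    unfold KCH.Tube.IsStableAPolynomial at hA
    rw [hUV] at hA
    rcases hq.eq_or_eq_neg hA with rfl | rfl
    · exact Or.inl rfl
    · exact Or.inr (mul_neg _ _)
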